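/- Let $\gamma=\mu+i\sigma$ with $\mu\in\mathbb R$ and $\sigma>0$, and let $C(\gamma)$ denote the Cauchy distribution on $\mathbb R$ with location $\mu$ and scale $\sigma$, i.e. with density $x\mapsto \frac{\sigma}{\pi}\,\frac{1}{(x-\mu)^2+\sigma^2}$. For $z\in\mathbb C\setminus\{0\}$ let $\arg z\in[0,2\pi)$ be its argument. Fix $k\in\mathbb Z$, put $\log z=\log|z|+i(\arg z+2k\pi)$ and, for $p\in\mathbb R$, $z^p=\exp(p\log z)$ (so all powers are taken with the same branch of the logarithm). Let $X_1,X_2,\ldots$ be independent real random variables, each with distribution $C(\gamma)$. Then $$\frac{\sqrt N}{\sqrt v\,\gamma}\Bigl(\prod_{j=1}^N X_j^{1/N}-\gamma\Bigr)\longrightarrow Z_{0,1}\qquad\text{in law as } N\to\infty,$$ where $v=2\arg\gamma\,(\pi-\arg\gamma)$ and $Z_{0,1}$ is a standard complex normal random variable, i.e. $\mathrm{Re}\,Z_{0,1}$ and $\mathrm{Im}\,Z_{0,1}$ are independent and both are $N(0,1/2)$-distributed. -/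

import Mathlib

open MeasureTheory ProbabilityTheory Filter

noncomputable section

namespace CauchyGM

/-- The argument of a complex number, normalised to lie in `[0, 2π)`. -/
def arg (z : ℂ) : ℝ := toIcoMod Real.two_pi_pos 0 (Complex.arg z)

/-- The `k`-th branch of the complex logarithm, `log |z| + i (arg z + 2kπ)` with
`0 ≤ arg z < 2π`. -/
def log (k : ℤ) (z : ℂ) : ℂ :=
  (Real.log ‖z‖ : ℂ) + ((arg z + 2 * k * Real.pi : ℝ) : ℂ) * Complex.I

/-- The real power `z ^ p = exp (p log z)`, taken with the `k`-th branch of the logarithm. -/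
def pow (k : ℤ) (z : ℂ) (p : ℝ) : ℂ := Complex.exp ((p : ℂ) * log k z)

/-- The Cauchy distribution `C(γ)` with location `Re γ` and scale `Im γ` (used for `0 < Im γ`). -/
def cauchyLaw (γ : ℂ) : Measure ℝ := cauchyMeasure γ.re γ.im.toNNReal

/-- The geometric mean `∏ x_j ^ (1/N)` of the first `N` terms of a real sequence, every power
being taken with the same branch `k`. -/
def geomMean (k : ℤ) (x : ℕ → ℝ) (N : ℕ) : ℂ :=
  ∏ j ∈ Finset.range N, pow k (x j : ℂ) (1 / (N : ℝ))

/-- The constant `2 arg γ (π - arg γ)`. -/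
def asympVar (γ : ℂ) : ℝ := 2 * arg γ * (Real.pi - arg γ)

/-- `Z` is a standard complex normal random variable: its real and imaginary parts are
independent and both are `N(0, 1/2)`-distributed. -/
structure IsStdComplexNormal {Ω : Type*} [MeasurableSpace Ω] (Z : Ω → ℂ) (P : Measure Ω) :
    Prop where
  re_law : HasLaw (fun ω => (Z ω).re) (gaussianReal 0 (1 / 2)) P
  im_law : HasLaw (fun ω => (Z ω).im) (gaussianReal 0 (1 / 2)) P
  indep : IndepFun (fun ω => (Z ω).re) (fun ω => (Z ω).im) P

end CauchyGM

end

noncomputable section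

namespace CauchyGM

open scoped Topology ComplexConjugate Real

/-! The Cayley transform w = (x - γ)/(x - conj γ) carries C(γ) to the uniform law on the unit
circle. For real x ≠ 0, log x - log γ does not depend on the branch and is the boundary value of
L(w) = log(1 - (conj γ/γ) w) - log(1 - w), which is holomorphic in the disc with L(0) = 0
(`log_ofReal_eq`). The mean value property, applied to L(rw) and L(rw)² with r → 1, gives E L = 0
and E L² = 0 (`integral_centeredLog_pow`). The second identity says that the real and imaginary
parts are uncorrelated with equal variances. Since arg x is 0 or π, Im L takes only two values, and
its variance is arg γ (π - arg γ) = v/2 (`integral_im_centeredLog_sq`).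

The geometric mean equals γ exp of the average of the L's (`geomMean_eq`), so a circular complex CLT
and the delta method for exp at 0 conclude. -/

/-! ### Cauchy law and Cayley transform -/

lemma ofReal_sub_conj_ne_zero {γ : ℂ} (hγ : 0 < γ.im) (x : ℝ) : (x : ℂ) - conj γ ≠ 0 := by
  intro h
  have := congrArg Complex.im h
  simp at this
  exact hγ.ne' this

lemma ofReal_sub_ne_zero {γ : ℂ} (hγ : 0 < γ.im) (x : ℝ) : (x : ℂ) - γ ≠ 0 := by
  intro h
  have := congrArg Complex.im h
  simp at this
  exact hγ.ne' this

lemma ne_zero_of_im_pos {γ : ℂ} (hγ : 0 < γ.im) : γ ≠ 0 := by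
  rintro rfl
  simp at hγ

/-- The Cayley transform mapping the upper half plane to the unit disc and `γ` to `0`. -/
def cayley (γ : ℂ) (x : ℝ) : ℂ := ((x : ℂ) - γ) / ((x : ℂ) - conj γ)

lemma norm_ofReal_sub_conj (γ : ℂ) (x : ℝ) : ‖(x : ℂ) - conj γ‖ = ‖(x : ℂ) - γ‖ := by
  rw [← Complex.norm_conj]
  simp

lemma norm_cayley {γ : ℂ} (hγ : 0 < γ.im) (x : ℝ) : ‖cayley γ x‖ = 1 := by
  rw [cayley, norm_div, norm_ofReal_sub_conj, div_self]
  exact norm_ne_zero_iff.2 (ofReal_sub_ne_zero hγ x)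

lemma normSq_ofReal_sub (γ : ℂ) (x : ℝ) :
    ‖(x : ℂ) - γ‖ ^ 2 = (x - γ.re) ^ 2 + γ.im ^ 2 := by
  rw [← Complex.normSq_eq_norm_sq, Complex.normSq_apply]
  simp
  ring

lemma cauchyLaw_eq {γ : ℂ} (hγ : 0 < γ.im) :
    cauchyLaw γ = volume.withDensity (cauchyPDF γ.re γ.im.toNNReal) := by
  rw [cauchyLaw, cauchyMeasure, if_neg]
  simpa using hγ

instance (γ : ℂ) : IsProbabilityMeasure (cauchyLaw γ) := by
  unfold cauchyLaw; infer_instance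

lemma cauchyLaw_absolutelyContinuous {γ : ℂ} (hγ : 0 < γ.im) : cauchyLaw γ ≪ volume := by
  rw [cauchyLaw_eq hγ]
  exact withDensity_absolutelyContinuous _ _

lemma cauchyPDFReal_eq {γ : ℂ} (hγ : 0 < γ.im) (x : ℝ) :
    cauchyPDFReal γ.re γ.im.toNNReal x = γ.im / Real.pi * (‖(x : ℂ) - γ‖ ^ 2)⁻¹ := by
  rw [normSq_ofReal_sub, cauchyPDFReal, Real.coe_toNNReal _ hγ.le]
  field_simp

lemma integral_cauchyLaw {E : Type*} [NormedAddCommGroup E] [NormedSpace ℝ E] {γ : ℂ}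
    (hγ : 0 < γ.im) (f : ℝ → E) :
    ∫ x, f x ∂(cauchyLaw γ) = ∫ x, cauchyPDFReal γ.re γ.im.toNNReal x • f x := by
  rw [cauchyLaw_eq hγ, integral_withDensity_eq_integral_toReal_smul (by fun_prop)
    (by simp [cauchyPDF])]
  refine integral_congr_ae (ae_of_all _ fun x => ?_)
  simp only [cauchyPDF]
  rw [ENNReal.toReal_ofReal (cauchyPDF_pos _ (by simpa using hγ) x).le]

lemma integrable_cauchyLaw_iff {E : Type*} [NormedAddCommGroup E] [NormedSpace ℝ E] {γ : ℂ}
    (hγ : 0 < γ.im) (f : ℝ → E) :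
    Integrable f (cauchyLaw γ) ↔
      Integrable (fun x => cauchyPDFReal γ.re γ.im.toNNReal x • f x) := by
  rw [cauchyLaw_eq hγ, integrable_withDensity_iff_integrable_smul' (by fun_prop)
    (by simp [cauchyPDF])]
  refine integrable_congr (ae_of_all _ fun x => ?_)
  simp only [cauchyPDF]
  rw [ENNReal.toReal_ofReal (cauchyPDF_pos _ (by simpa using hγ) x).le]

/-- This is dw/(2πi w) = density · dx: arc length on the circle pulls back to the Cauchy law. -/
lemma hasDerivAt_cayley {γ : ℂ} (hγ : 0 < γ.im) (x : ℝ) :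
    HasDerivAt (cayley γ)
      (2 * Real.pi * Complex.I * cayley γ x * cauchyPDFReal γ.re γ.im.toNNReal x) x := by
  have h1 := ofReal_sub_conj_ne_zero hγ x
  have h2 := ofReal_sub_ne_zero hγ x
  have h := ((Complex.ofRealCLM.hasDerivAt (x := x)).sub_const γ).div
    ((Complex.ofRealCLM.hasDerivAt (x := x)).sub_const (conj γ)) h1
  have h3 : ((‖(x : ℂ) - γ‖ : ℂ) ^ 2) = ((x : ℂ) - γ) * ((x : ℂ) - conj γ) := by
    rw [← Complex.mul_conj']
    simp
  have h4 : γ - conj γ = 2 * γ.im * Complex.I := by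
    rw [Complex.sub_conj]; push_cast; ring
  refine h.congr_deriv (Eq.symm ?_)
  rw [cauchyPDFReal_eq hγ]
  push_cast
  rw [h3, cayley]
  have : (Real.pi : ℂ) ≠ 0 := by exact_mod_cast Real.pi_ne_zero
  simp only [Complex.ofRealCLM_apply, Complex.ofReal_one, one_mul, mul_one]
  have h5 : (x : ℂ) - conj γ - (x - γ) = 2 * γ.im * Complex.I := by rw [← h4]; ring
  rw [h5]
  field_simp

lemma continuous_cayley {γ : ℂ} (hγ : 0 < γ.im) : Continuous (cayley γ) :=
  continuous_iff_continuousAt.2 fun x => (hasDerivAt_cayley hγ x).continuousAt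

lemma one_sub_cayley {γ : ℂ} (hγ : 0 < γ.im) (x : ℝ) :
    1 - cayley γ x = (γ - conj γ) / ((x : ℂ) - conj γ) := by
  have h1 := ofReal_sub_conj_ne_zero hγ x
  rw [cayley]
  field_simp
  ring

lemma tendsto_cayley {γ : ℂ} (hγ : 0 < γ.im) : Tendsto (cayley γ) (cocompact ℝ) (𝓝 1) := by
  have h : Tendsto (fun x : ℝ => (x : ℂ) - conj γ) (cocompact ℝ) (cocompact ℂ) := by
    have h1 : Tendsto (fun x : ℝ => (x : ℂ)) (cocompact ℝ) (cocompact ℂ) :=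
      Complex.isometry_ofReal.isClosedEmbedding.tendsto_cocompact
    exact (Homeomorph.subRight (conj γ)).isClosedEmbedding.tendsto_cocompact.comp h1
  have h2 : Tendsto (fun x : ℝ => (γ - conj γ) * ((x : ℂ) - conj γ)⁻¹) (cocompact ℝ) (𝓝 0) := by
    rw [← mul_zero (γ - conj γ)]
    rw [← Metric.cobounded_eq_cocompact (α := ℂ)] at h
    exact (tendsto_inv₀_cobounded.comp h).const_mul (γ - conj γ)
  have h3 := h2.const_sub 1
  rw [sub_zero] at h3
  refine h3.congr fun x => ?_
  rw [← div_eq_mul_inv, ← one_sub_cayley hγ]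
  ring

/-- The mean value property: the Cayley transform of a Cauchy variable is uniform on the circle. -/
lemma integral_comp_cayley_eq_zero {γ : ℂ} (hγ : 0 < γ.im) {R : ℝ} (hR : 1 < R) {G : ℂ → ℂ}
    (hG : DifferentiableOn ℂ G (Metric.ball 0 R)) (hG0 : G 0 = 0) :
    ∫ x, G (cayley γ x) ∂(cauchyLaw γ) = 0 := by
  have hmem : ∀ x, cayley γ x ∈ Metric.ball (0 : ℂ) R := fun x => by
    simpa [norm_cayley hγ] using hR
  -- Write G(w) = w H(w) and let K be a primitive of H on the disc. Then 2πi · density · G(w) is the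
  -- derivative of K(w) in x, and K(w) tends to K(1) at both ends of the line.
  have hH : DifferentiableOn ℂ (dslope G 0) (Metric.ball 0 R) :=
    (Complex.differentiableOn_dslope (Metric.ball_mem_nhds _ (by linarith))).2 hG
  obtain ⟨K, hK⟩ := hH.isExactOn_ball
  have hGeq : ∀ z, G z = z * dslope G 0 z := fun z => by
    have := sub_smul_dslope G 0 z
    simpa [hG0] using this.symm
  have hKd : ∀ x : ℝ, HasDerivAt (fun x => K (cayley γ x)) ((2 * Real.pi * Complex.I) *
      (cauchyPDFReal γ.re γ.im.toNNReal x • G (cayley γ x))) x := fun x => by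
    have := (hK (cayley γ x) (hmem x)).comp x (hasDerivAt_cayley hγ x)
    refine this.congr_deriv (Eq.symm ?_)
    rw [hGeq, Complex.real_smul]
    ring
  have hint : Integrable (fun x => G (cayley γ x)) (cauchyLaw γ) := by
    obtain ⟨C, hC⟩ := (isCompact_sphere (0 : ℂ) 1).exists_bound_of_continuousOn
      (hG.continuousOn.mono (Metric.sphere_subset_closedBall.trans
        (Metric.closedBall_subset_ball hR)))
    refine Integrable.of_bound (C := C) ?_ (ae_of_all _ fun x => hC _ (by simp [norm_cayley hγ]))
    exact (hG.continuousOn.comp_continuous (continuous_cayley hγ) hmem).aestronglyMeasurable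
  rw [integrable_cauchyLaw_iff hγ] at hint
  have h1 : ContinuousAt K 1 := (hK 1 (by simpa using hR)).continuousAt
  have hlim := h1.tendsto.comp (tendsto_cayley hγ)
  rw [cocompact_eq_atBot_atTop, tendsto_sup] at hlim
  have := integral_of_hasDerivAt_of_tendsto hKd (hint.const_mul _) hlim.1 hlim.2
  rw [integral_const_mul, sub_self, ← integral_cauchyLaw hγ] at this
  refine (mul_eq_zero.1 this).resolve_left ?_
  simp [Real.pi_ne_zero]

/-! ### Bounds for the logarithm, uniform up to the circle -/

lemma re_one_sub_mul_pos {u : ℂ} (hu : ‖u‖ ≤ 1) {r : ℝ} (hr0 : 0 ≤ r) (hr1 : r < 1) :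
    0 < (1 - r * u).re := by
  have h1 : u.re ≤ 1 := (Complex.re_le_norm u).trans hu
  simp
  nlinarith

lemma re_one_sub_pos {u : ℂ} (hu : ‖u‖ = 1) (hu1 : u ≠ 1) : 0 < (1 - u).re := by
  have h1 : u.re ≤ 1 := (Complex.re_le_norm u).trans hu.le
  rcases h1.lt_or_eq with h | h
  · simpa using h
  · have h2 : u.re * u.re + u.im * u.im = 1 := by
      rw [← Complex.normSq_apply, Complex.normSq_eq_norm_sq, hu, one_pow]
    have h3 : u.im = 0 := by
      rw [h] at h2
      nlinarith
    exact absurd (Complex.ext (by simpa using h) (by simpa using h3)) hu1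

/-- Any small negative power dominates the logarithm; with -1/4 the square has the integrable
singularity -1/2. The additive constants are absorbed because the power is at least 1/2. -/
lemma norm_log_le_rpow {z : ℂ} (hz : 0 < z.re) (hz2 : ‖z‖ ≤ 2) :
    ‖Complex.log z‖ ≤ 10 * ‖z‖ ^ (-(1 / 4) : ℝ) := by
  have hz0 : z ≠ 0 := by rintro rfl; simp at hz
  have hn : 0 < ‖z‖ := norm_pos_iff.2 hz0
  have h1 : ‖Complex.log z‖ ≤ |Real.log ‖z‖| + |Complex.arg z| := by
    simpa [Complex.log_re, Complex.log_im] using Complex.norm_le_abs_re_add_abs_im (Complex.log z)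
  have h2 : |Complex.arg z| ≤ 2 := by
    have := Complex.abs_arg_le_pi_div_two_iff.2 hz.le
    linarith [Real.pi_le_four]
  have h3 : (1 / 2 : ℝ) ≤ ‖z‖ ^ (-(1 / 4) : ℝ) := by
    calc (1 / 2 : ℝ) = 2 ^ (-1 : ℝ) := by norm_num [Real.rpow_neg_one]
      _ ≤ 2 ^ (-(1 / 4) : ℝ) := Real.rpow_le_rpow_of_exponent_le (by norm_num) (by norm_num)
      _ ≤ _ := Real.rpow_le_rpow_of_nonpos hn hz2 (by norm_num)
  have h4 : |Real.log ‖z‖| ≤ 1 + 4 * ‖z‖ ^ (-(1 / 4) : ℝ) := by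
    rw [abs_le]
    have e1 := Real.log_le_sub_one_of_pos hn
    have e2 := Real.log_le_sub_one_of_pos (Real.rpow_pos_of_pos hn (-(1 / 4) : ℝ))
    rw [Real.log_rpow hn] at e2
    constructor <;> linarith
  linarith

/-- The bound is uniform in r because ‖1 - u‖ ≤ 2‖1 - ru‖: both ‖1 - ru‖ ≥ 1 - r and ‖1 - u‖ ≤ ‖1 -
ru‖ + (1 - r) hold. -/
lemma norm_log_one_sub_mul_le {u : ℂ} (hu : ‖u‖ = 1) (hu1 : u ≠ 1) {r : ℝ} (hr0 : 0 ≤ r)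
    (hr1 : r < 1) : ‖Complex.log (1 - r * u)‖ ≤ 20 * ‖1 - u‖ ^ (-(1 / 4) : ℝ) := by
  have hre := re_one_sub_mul_pos hu.le hr0 hr1
  have hru : ‖(r : ℂ) * u‖ = r := by simp [hu, abs_of_nonneg hr0]
  have h2 : ‖1 - r * u‖ ≤ 2 := by
    refine (norm_sub_le _ _).trans ?_
    rw [hru, norm_one]; linarith
  have h3 : ‖1 - u‖ / 2 ≤ ‖1 - r * u‖ := by
    have e1 : 1 - r ≤ ‖1 - r * u‖ := by
      have := norm_sub_norm_le 1 ((r : ℂ) * u)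
      rwa [hru, norm_one] at this
    have e2 : ‖1 - u‖ ≤ ‖1 - r * u‖ + (1 - r) := by
      have : 1 - u = (1 - r * u) - ((1 - r : ℝ) : ℂ) * u := by push_cast; ring
      rw [this]
      refine (norm_sub_le _ _).trans ?_
      rw [norm_mul, hu, Complex.norm_real, Real.norm_of_nonneg (by linarith), mul_one]
    linarith
  have h4 : 0 < ‖1 - u‖ := norm_pos_iff.2 (sub_ne_zero.2 hu1.symm)
  have h5 : ‖1 - r * u‖ ^ (-(1 / 4) : ℝ) ≤ 2 * ‖1 - u‖ ^ (-(1 / 4) : ℝ) := by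
    calc ‖1 - r * u‖ ^ (-(1 / 4) : ℝ) ≤ (‖1 - u‖ / 2) ^ (-(1 / 4) : ℝ) :=
          Real.rpow_le_rpow_of_nonpos (by positivity) h3 (by norm_num)
      _ = 2 ^ (1 / 4 : ℝ) * ‖1 - u‖ ^ (-(1 / 4) : ℝ) := by
          rw [Real.div_rpow h4.le (by norm_num), Real.rpow_neg (x := 2) (by norm_num), div_inv_eq_mul,
            mul_comm]
      _ ≤ _ := by
          gcongr
          calc (2 : ℝ) ^ (1 / 4 : ℝ) ≤ 2 ^ (1 : ℝ) :=
                Real.rpow_le_rpow_of_exponent_le (by norm_num) (by norm_num)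
            _ = 2 := Real.rpow_one 2
  linarith [norm_log_le_rpow hre h2]

/-! ### The centered logarithm and its branch -/

/-- The Cayley transform rotated so that the origin corresponds to `1`. -/
def cayleyRot (γ : ℂ) (x : ℝ) : ℂ := conj γ / γ * cayley γ x

lemma norm_conj_div_self {γ : ℂ} (hγ : 0 < γ.im) : ‖conj γ / γ‖ = 1 := by
  have := norm_ne_zero_iff.2 (ne_zero_of_im_pos hγ)
  simp [this]

lemma norm_cayleyRot {γ : ℂ} (hγ : 0 < γ.im) (x : ℝ) : ‖cayleyRot γ x‖ = 1 := by
  rw [cayleyRot, norm_mul, norm_conj_div_self hγ, norm_cayley hγ, mul_one]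

lemma sub_conj_ne_zero {γ : ℂ} (hγ : 0 < γ.im) : γ - conj γ ≠ 0 := by
  rw [Complex.sub_conj]
  simp [hγ.ne']

lemma cayley_ne_one {γ : ℂ} (hγ : 0 < γ.im) (x : ℝ) : cayley γ x ≠ 1 := by
  intro h
  have := one_sub_cayley hγ x
  rw [h, sub_self] at this
  exact div_ne_zero (sub_conj_ne_zero hγ) (ofReal_sub_conj_ne_zero hγ x) this.symm

lemma one_sub_cayleyRot {γ : ℂ} (hγ : 0 < γ.im) (x : ℝ) :
    1 - cayleyRot γ x = (γ - conj γ) / γ * x / ((x : ℂ) - conj γ) := by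
  have h1 := ofReal_sub_conj_ne_zero hγ x
  have h2 := ne_zero_of_im_pos hγ
  rw [cayleyRot, cayley]
  field_simp
  ring

lemma cayleyRot_ne_one {γ : ℂ} (hγ : 0 < γ.im) {x : ℝ} (hx : x ≠ 0) : cayleyRot γ x ≠ 1 := by
  intro h
  have := one_sub_cayleyRot hγ x
  rw [h, sub_self] at this
  have hx' : (x : ℂ) ≠ 0 := by exact_mod_cast hx
  exact div_ne_zero (mul_ne_zero (div_ne_zero (sub_conj_ne_zero hγ) (ne_zero_of_im_pos hγ)) hx')
    (ofReal_sub_conj_ne_zero hγ x) this.symm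

/-- The centered logarithm of a real number, seen as a boundary value of the holomorphic function
`log z - log γ`. -/
def centeredLog (γ : ℂ) (x : ℝ) : ℂ :=
  Complex.log (1 - cayleyRot γ x) - Complex.log (1 - cayley γ x)

lemma measurable_centeredLog {γ : ℂ} (hγ : 0 < γ.im) : Measurable (centeredLog γ) := by
  have := (continuous_cayley hγ).measurable
  unfold centeredLog cayleyRot
  fun_prop

lemma arg_eq_complex_arg {γ : ℂ} (hγ : 0 < γ.im) : arg γ = Complex.arg γ := by
  rw [arg, toIcoMod_eq_self]
  refine ⟨Complex.arg_nonneg_iff.2 hγ.le, ?_⟩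
  linarith [Complex.arg_le_pi γ, Real.pi_pos]

lemma arg_mem_Ioo {γ : ℂ} (hγ : 0 < γ.im) : arg γ ∈ Set.Ioo 0 π := by
  rw [arg_eq_complex_arg hγ]
  have h0 : 0 ≤ Complex.arg γ := Complex.arg_nonneg_iff.2 hγ.le
  refine ⟨h0.lt_of_ne' fun h => ?_, (Complex.arg_le_pi γ).lt_of_ne fun h => ?_⟩
  · exact hγ.ne' (Complex.arg_eq_zero_iff.1 h).2
  · exact hγ.ne' (Complex.arg_eq_pi_iff.1 h).2

lemma arg_ofReal_of_pos {x : ℝ} (hx : 0 < x) : arg x = 0 := by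
  rw [arg, Complex.arg_ofReal_of_nonneg hx.le, toIcoMod_eq_self]
  exact ⟨le_rfl, by positivity⟩

lemma arg_ofReal_of_neg {x : ℝ} (hx : x < 0) : arg x = π := by
  rw [arg, Complex.arg_ofReal_of_neg hx, toIcoMod_eq_self]
  exact ⟨by positivity, by linarith [Real.pi_pos]⟩

/-- The quotient (1 - (conj γ/γ) w)/(1 - w) equals x/γ. -/
lemma mul_exp_centeredLog {γ : ℂ} (hγ : 0 < γ.im) {x : ℝ} (hx : x ≠ 0) :
    γ * Complex.exp (centeredLog γ x) = x := by
  have h1 := ofReal_sub_conj_ne_zero hγ x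
  have h2 := ne_zero_of_im_pos hγ
  have h3 := sub_conj_ne_zero hγ
  rw [centeredLog, Complex.exp_sub, Complex.exp_log (sub_ne_zero.2 (cayleyRot_ne_one hγ hx).symm),
    Complex.exp_log (sub_ne_zero.2 (cayley_ne_one hγ x).symm), one_sub_cayley hγ,
    one_sub_cayleyRot hγ]
  field_simp

lemma abs_arg_lt_pi_div_two {z : ℂ} (hz : 0 < z.re) : |Complex.arg z| < π / 2 :=
  Complex.abs_arg_lt_pi_div_two_iff.2 (Or.inl hz)

lemma abs_im_centeredLog_lt {γ : ℂ} (hγ : 0 < γ.im) {x : ℝ} (hx : x ≠ 0) :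
    |(centeredLog γ x).im| < π := by
  have h1 := abs_arg_lt_pi_div_two (re_one_sub_pos (norm_cayley hγ x) (cayley_ne_one hγ x))
  have h2 := abs_arg_lt_pi_div_two (re_one_sub_pos (norm_cayleyRot hγ x) (cayleyRot_ne_one hγ hx))
  simp only [centeredLog, Complex.sub_im, Complex.log_im]
  rw [abs_lt] at *
  constructor <;> linarith

lemma exp_log {k : ℤ} {z : ℂ} (hz : z ≠ 0) : Complex.exp (log k z) = z := by
  have h : arg z = Complex.arg z - toIcoDiv Real.two_pi_pos 0 (Complex.arg z) • (2 * π) := rfl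
  have h2 : log k z = Complex.log z +
      ((k - toIcoDiv Real.two_pi_pos 0 (Complex.arg z) : ℤ) : ℂ) * (2 * π * Complex.I) := by
    rw [log, h, Complex.log]
    push_cast
    simp only [zsmul_eq_mul]
    ring
  rw [h2, Complex.exp_add, Complex.exp_int_mul_two_pi_mul_I, mul_one, Complex.exp_log hz]

/-- Both sides have exponential x, so they differ by 2πin. Both arg x - arg γ and the imaginary part
of the centered logarithm lie in (-π, π), which forces n = 0; the branch index k cancels. -/
lemma log_ofReal_eq {γ : ℂ} (hγ : 0 < γ.im) (k : ℤ) {x : ℝ} (hx : x ≠ 0) :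
    log k x = log k γ + centeredLog γ x := by
  have hx' : (x : ℂ) ≠ 0 := by exact_mod_cast hx
  have h : Complex.exp (log k x) = Complex.exp (log k γ + centeredLog γ x) := by
    rw [Complex.exp_add, exp_log hx', exp_log (ne_zero_of_im_pos hγ), mul_exp_centeredLog hγ hx]
  obtain ⟨n, hn⟩ := Complex.exp_eq_exp_iff_exists_int.1 h
  have him := congrArg Complex.im hn
  have e1 : (log k x).im = arg x + 2 * k * π := by simp [log]
  have e2 : (log k γ).im = arg γ + 2 * k * π := by simp [log]
  have e3 : ((n : ℂ) * (2 * π * Complex.I)).im = n * (2 * π) := by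
    simp
  rw [Complex.add_im, Complex.add_im, e1, e2, e3] at him
  have h1 := arg_mem_Ioo hγ
  have h2 := abs_lt.1 (abs_im_centeredLog_lt hγ hx)
  have hpi := Real.pi_pos
  have h3 : arg x = 0 ∨ arg x = π := by
    rcases hx.lt_or_gt with h | h
    · exact Or.inr (arg_ofReal_of_neg h)
    · exact Or.inl (arg_ofReal_of_pos h)
  have h4 : (n : ℝ) < 1 := by
    rcases h3 with h3 | h3 <;> rw [h3] at him <;> nlinarith [h1.1, h1.2, h2.1, h2.2]
  have h5 : (-1 : ℝ) < n := by
    rcases h3 with h3 | h3 <;> rw [h3] at him <;> nlinarith [h1.1, h1.2, h2.1, h2.2]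
  have h6 : n = 0 := by
    have : n < 1 := by exact_mod_cast h4
    have : -1 < n := by exact_mod_cast h5
    omega
  rw [hn, h6]
  simp

/-- The only values are -arg γ and π - arg γ, the roots of this quadratic; it reduces the second
moment to the first. -/
lemma im_centeredLog_sq {γ : ℂ} (hγ : 0 < γ.im) {x : ℝ} (hx : x ≠ 0) :
    (centeredLog γ x).im ^ 2 =
      (π - 2 * arg γ) * (centeredLog γ x).im + arg γ * (π - arg γ) := by
  have him := congrArg Complex.im (log_ofReal_eq hγ 0 hx)
  simp [log] at him
  rcases hx.lt_or_gt with h | h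
  · rw [arg_ofReal_of_neg h] at him
    have : (centeredLog γ x).im = π - arg γ := by linarith
    rw [this]; ring
  · rw [arg_ofReal_of_pos h] at him
    have : (centeredLog γ x).im = - arg γ := by linarith
    rw [this]; ring

/-! ### An integrable majorant for the square -/

lemma norm_ofReal_sub_pos {γ : ℂ} (hγ : 0 < γ.im) (x : ℝ) : 0 < ‖(x : ℂ) - γ‖ :=
  norm_pos_iff.2 (ofReal_sub_ne_zero hγ x)

lemma integrable_norm_sub_rpow {γ : ℂ} (hγ : 0 < γ.im) :
    Integrable (fun x : ℝ => ‖(x : ℂ) - γ‖ ^ (-(3 / 2) : ℝ)) := by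
  have h := integrable_rpow_neg_one_add_norm_sq (E := ℝ) (μ := volume) (r := 3 / 2)
    (by norm_num)
  have h2 := ((h.comp_div hγ.ne').comp_sub_right γ.re).const_mul ((γ.im ^ 2) ^ (-(3 / 4) : ℝ))
  refine h2.congr (ae_of_all _ fun x => ?_)
  have e : ‖(x : ℂ) - γ‖ ^ (-(3 / 2) : ℝ) = (‖(x : ℂ) - γ‖ ^ 2) ^ (-(3 / 4) : ℝ) := by
    rw [← Real.rpow_natCast, ← Real.rpow_mul (norm_nonneg _)]
    norm_num
  beta_reduce
  rw [e, normSq_ofReal_sub]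
  simp only [Real.norm_eq_abs, sq_abs]
  rw [show (-(3 / 2) / 2 : ℝ) = -(3 / 4) by norm_num,
    ← Real.mul_rpow (by positivity) (by positivity)]
  congr 1
  field_simp
  ring

lemma im_le_norm_ofReal_sub (γ : ℂ) (x : ℝ) : γ.im ≤ ‖(x : ℂ) - γ‖ := by
  have := Complex.abs_im_le_norm ((x : ℂ) - γ)
  simp at this
  exact (le_abs_self _).trans this

lemma integrable_abs_rpow_mul_norm_sub_rpow {γ : ℂ} (hγ : 0 < γ.im) :
    Integrable (fun x : ℝ => |x| ^ (-(1 / 2) : ℝ) * ‖(x : ℂ) - γ‖ ^ (-(3 / 2) : ℝ)) := by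
  have h0 : IntegrableOn (fun x : ℝ => |x| ^ (-(1 / 2) : ℝ)) (Set.Ioc (-1) 1) := by
    have := (intervalIntegral.intervalIntegrable_cpow' (a := -1) (b := 1)
      (r := ((-(1 / 2) : ℝ) : ℂ)) (by norm_num)).1.norm
    refine this.congr ?_
    filter_upwards [ae_restrict_of_ae (Measure.ae_ne volume 0)] with x hx
    rw [Complex.norm_cpow_real]
    simp
  have h1 := (h0.integrable_indicator measurableSet_Ioc).mul_const (γ.im ^ (-(3 / 2) : ℝ))
  refine (h1.add (integrable_norm_sub_rpow hγ)).mono' (by fun_prop) (ae_of_all _ fun x => ?_)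
  have hp := norm_ofReal_sub_pos hγ x
  rw [Real.norm_of_nonneg (by positivity), Pi.add_apply]
  by_cases hx : x ∈ Set.Ioc (-1 : ℝ) 1
  · rw [Set.indicator_of_mem hx]
    have : ‖(x : ℂ) - γ‖ ^ (-(3 / 2) : ℝ) ≤ γ.im ^ (-(3 / 2) : ℝ) :=
      Real.rpow_le_rpow_of_nonpos hγ (im_le_norm_ofReal_sub γ x) (by norm_num)
    have h2 : 0 ≤ ‖(x : ℂ) - γ‖ ^ (-(3 / 2) : ℝ) := by positivity
    have h3 := mul_le_mul_of_nonneg_left this (show 0 ≤ |x| ^ (-(1 / 2) : ℝ) by positivity)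
    linarith
  · rw [Set.indicator_of_notMem hx, zero_mul, zero_add]
    have hx1 : 1 ≤ |x| := by
      by_contra! h
      exact hx ⟨(abs_lt.1 h).1, (abs_lt.1 h).2.le⟩
    exact mul_le_of_le_one_left (by positivity)
      (Real.rpow_le_one_of_one_le_of_nonpos hx1 (by norm_num))

/-- The singularity sits at x = ∞: the density has order -2 and the factor contributes 1/2, leaving
-3/2. -/
lemma integrable_norm_one_sub_cayley {γ : ℂ} (hγ : 0 < γ.im) :
    Integrable (fun x => ‖1 - cayley γ x‖ ^ (-(1 / 2) : ℝ)) (cauchyLaw γ) := by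
  rw [integrable_cauchyLaw_iff hγ]
  refine ((integrable_norm_sub_rpow hγ).const_mul
    (γ.im / π * ‖γ - conj γ‖ ^ (-(1 / 2) : ℝ))).congr (ae_of_all _ fun x => ?_)
  have hp := norm_ofReal_sub_pos hγ x
  simp only
  rw [cauchyPDFReal_eq hγ, one_sub_cayley hγ, norm_div, norm_ofReal_sub_conj,
    Real.div_rpow (norm_nonneg _) (norm_nonneg _), smul_eq_mul,
    show (-(3 / 2) : ℝ) = -2 - (-(1 / 2)) by norm_num, Real.rpow_sub hp,
    Real.rpow_neg hp.le 2, Real.rpow_two]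
  ring

/-- Here the singularity sits at x = 0 and has the integrable order |x|^(-1/2). -/
lemma integrable_norm_one_sub_cayleyRot {γ : ℂ} (hγ : 0 < γ.im) :
    Integrable (fun x => ‖1 - cayleyRot γ x‖ ^ (-(1 / 2) : ℝ)) (cauchyLaw γ) := by
  rw [integrable_cauchyLaw_iff hγ]
  refine ((integrable_abs_rpow_mul_norm_sub_rpow hγ).const_mul
    (γ.im / π * ‖(γ - conj γ) / γ‖ ^ (-(1 / 2) : ℝ))).congr (ae_of_all _ fun x => ?_)
  have hp := norm_ofReal_sub_pos hγ x
  simp only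
  rw [cauchyPDFReal_eq hγ, one_sub_cayleyRot hγ, norm_div _ ((x : ℂ) - conj γ), norm_mul,
    norm_ofReal_sub_conj, Complex.norm_real, Real.norm_eq_abs,
    Real.div_rpow (by positivity) (norm_nonneg _), Real.mul_rpow (norm_nonneg _) (abs_nonneg _),
    smul_eq_mul,
    show (-(3 / 2) : ℝ) = -2 - (-(1 / 2)) by norm_num, Real.rpow_sub hp,
    Real.rpow_neg hp.le 2, Real.rpow_two]
  ring

/-- The dilated approximation of `centeredLog` used in passing to the boundary. -/
def centeredLogAux (γ : ℂ) (r x : ℝ) : ℂ :=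
  Complex.log (1 - r * cayleyRot γ x) - Complex.log (1 - r * cayley γ x)

/-- An integrable function dominating the square of the centered logarithm. -/
def centeredLogBound (γ : ℂ) (x : ℝ) : ℝ :=
  800 * (‖1 - cayleyRot γ x‖ ^ (-(1 / 2) : ℝ) + ‖1 - cayley γ x‖ ^ (-(1 / 2) : ℝ))

lemma integrable_centeredLogBound {γ : ℂ} (hγ : 0 < γ.im) :
    Integrable (centeredLogBound γ) (cauchyLaw γ) :=
  ((integrable_norm_one_sub_cayleyRot hγ).add (integrable_norm_one_sub_cayley hγ)).const_mul 800

lemma norm_centeredLogAux_sq_le {γ : ℂ} (hγ : 0 < γ.im) {r : ℝ} (hr0 : 0 ≤ r) (hr1 : r < 1)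
    {x : ℝ} (hx : x ≠ 0) : ‖centeredLogAux γ r x‖ ^ 2 ≤ centeredLogBound γ x := by
  have h1 := norm_log_one_sub_mul_le (norm_cayley hγ x) (cayley_ne_one hγ x) hr0 hr1
  have h2 := norm_log_one_sub_mul_le (norm_cayleyRot hγ x) (cayleyRot_ne_one hγ hx) hr0 hr1
  have h3 : ‖centeredLogAux γ r x‖ ≤ _ := (norm_sub_le _ _).trans (add_le_add h2 h1)
  have e : ∀ y : ℝ, 0 ≤ y → y ^ (-(1 / 2) : ℝ) = (y ^ (-(1 / 4) : ℝ)) ^ 2 := fun y hy => by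
    rw [← Real.rpow_natCast, ← Real.rpow_mul hy]
    norm_num
  rw [centeredLogBound, e _ (norm_nonneg _), e _ (norm_nonneg _)]
  refine (pow_le_pow_left₀ (norm_nonneg _) h3 2).trans ?_
  -- (20a + 20b)² ≤ 800(a² + b²), whence the constant in the majorant.
  nlinarith [sq_nonneg (‖1 - cayleyRot γ x‖ ^ (-(1 / 4) : ℝ) - ‖1 - cayley γ x‖ ^ (-(1 / 4) : ℝ))]

lemma tendsto_centeredLogAux {γ : ℂ} (hγ : 0 < γ.im) {x : ℝ} (hx : x ≠ 0) {r : ℕ → ℝ}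
    (hr : Tendsto r atTop (𝓝 1)) :
    Tendsto (fun m => centeredLogAux γ (r m) x) atTop (𝓝 (centeredLog γ x)) := by
  have key : ∀ u : ℂ, ‖u‖ = 1 → u ≠ 1 →
      Tendsto (fun m => Complex.log (1 - r m * u)) atTop (𝓝 (Complex.log (1 - u))) := by
    intro u hu hu1
    have h1 : Tendsto (fun m => 1 - (r m : ℂ) * u) atTop (𝓝 (1 - u)) := by
      have := (((Complex.continuous_ofReal.tendsto 1).comp hr).mul_const u).const_sub 1
      simpa using this
    exact h1.clog (Or.inl (re_one_sub_pos hu hu1))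
  exact (key _ (norm_cayleyRot hγ x) (cayleyRot_ne_one hγ hx)).sub
    (key _ (norm_cayley hγ x) (cayley_ne_one hγ x))

lemma tendsto_natCast_div_add_one : Tendsto (fun m : ℕ => (m : ℝ) / (m + 1)) atTop (𝓝 1) := by
  exact_mod_cast tendsto_natCast_div_add_atTop (1 : ℝ)

lemma ae_ne_zero_cauchyLaw {γ : ℂ} (hγ : 0 < γ.im) : ∀ᵐ x ∂(cauchyLaw γ), x ≠ 0 :=
  (cauchyLaw_absolutelyContinuous hγ).ae_le (Measure.ae_ne volume 0)

lemma norm_centeredLog_sq_le {γ : ℂ} (hγ : 0 < γ.im) {x : ℝ} (hx : x ≠ 0) :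
    ‖centeredLog γ x‖ ^ 2 ≤ centeredLogBound γ x := by
  refine le_of_tendsto (((tendsto_centeredLogAux hγ hx tendsto_natCast_div_add_one).norm).pow 2)
    (Eventually.of_forall fun m => norm_centeredLogAux_sq_le hγ (by positivity) ?_ hx)
  rw [div_lt_one (by positivity)]
  linarith

lemma memLp_centeredLog {γ : ℂ} (hγ : 0 < γ.im) : MemLp (centeredLog γ) 2 (cauchyLaw γ) := by
  have hm := (measurable_centeredLog hγ).aestronglyMeasurable (μ := cauchyLaw γ)
  rw [memLp_two_iff_integrable_sq_norm hm]
  refine (integrable_centeredLogBound hγ).mono' (by fun_prop) ?_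
  filter_upwards [ae_ne_zero_cauchyLaw hγ] with x hx
  rw [Real.norm_of_nonneg (by positivity)]
  exact norm_centeredLog_sq_le hγ hx

/-! ### Moments of the centered logarithm -/

lemma integral_centeredLogAux_pow {γ : ℂ} (hγ : 0 < γ.im) {r : ℝ} (hr0 : 0 ≤ r) (hr1 : r < 1)
    {n : ℕ} (hn : n ≠ 0) : ∫ x, centeredLogAux γ r x ^ n ∂(cauchyLaw γ) = 0 := by
  -- The dilated function stays holomorphic where r‖w‖ < 1, a disc strictly larger than the unit
  -- disc.
  obtain ⟨R, hR1, hR⟩ : ∃ R : ℝ, 1 < R ∧ r * R < 1 := by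
    refine ⟨2 / (1 + r), ?_, ?_⟩
    · rw [lt_div_iff₀ (by linarith)]; linarith
    · rw [mul_div_assoc', div_lt_one (by linarith)]; linarith
  have key : ∀ c : ℂ, ‖c‖ = 1 →
      DifferentiableOn ℂ (fun w : ℂ => Complex.log (1 - r * (c * w))) (Metric.ball 0 R) := by
    intro c hc w hw
    have hw' : ‖w‖ < R := by simpa using hw
    refine (DifferentiableAt.clog (by fun_prop) (Or.inl ?_)).differentiableWithinAt
    have : ((r : ℂ) * (c * w)).re < 1 := by
      refine (Complex.re_le_norm _).trans_lt ?_
      rw [norm_mul, norm_mul, hc, one_mul, Complex.norm_real, Real.norm_of_nonneg hr0]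
      nlinarith [norm_nonneg w]
    rw [Complex.sub_re, Complex.one_re]
    linarith
  have h2 := key 1 norm_one
  simp only [one_mul] at h2
  refine integral_comp_cayley_eq_zero hγ hR1
    (((key _ (norm_conj_div_self hγ)).sub h2).pow n) ?_
  simp [hn]

lemma integral_centeredLog_pow {γ : ℂ} (hγ : 0 < γ.im) {n : ℕ} (hn : n ≠ 0) (hn2 : n ≤ 2) :
    ∫ x, centeredLog γ x ^ n ∂(cauchyLaw γ) = 0 := by
  have hr1 : ∀ m : ℕ, (m : ℝ) / (m + 1) < 1 := fun m => by
    rw [div_lt_one (by positivity)]; linarith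
  have hc := (continuous_cayley hγ).measurable
  have h := tendsto_integral_of_dominated_convergence (μ := cauchyLaw γ)
    (F := fun (m : ℕ) x => centeredLogAux γ (m / (m + 1)) x ^ n)
    (f := fun x => centeredLog γ x ^ n) (fun x => 1 + centeredLogBound γ x)
    (fun m => by
      unfold centeredLogAux cayleyRot
      exact Measurable.aestronglyMeasurable (by fun_prop))
    ((integrable_const 1).add (integrable_centeredLogBound hγ))
    (fun m => by
      filter_upwards [ae_ne_zero_cauchyLaw hγ] with x hx
      have h1 := norm_centeredLogAux_sq_le hγ (r := m / (m + 1)) (by positivity) (hr1 m) hx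
      rw [norm_pow]
      -- For n ≤ 2, the n-th power is at most 1 or at most the square, which explains the majorant
      -- with 1 added.
      rcases le_total ‖centeredLogAux γ (m / (m + 1)) x‖ 1 with h | h
      · have := pow_le_one₀ (n := n) (norm_nonneg _) h
        nlinarith [sq_nonneg ‖centeredLogAux γ (m / (m + 1)) x‖]
      · have := pow_le_pow_right₀ h hn2
        linarith)
    (by
      filter_upwards [ae_ne_zero_cauchyLaw hγ] with x hx
      exact (tendsto_centeredLogAux hγ hx tendsto_natCast_div_add_one).pow n)
  refine tendsto_nhds_unique h ?_
  simp_rw [fun m : ℕ => integral_centeredLogAux_pow hγ (r := m / (m + 1)) (by positivity) (hr1 m) hn]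
  exact tendsto_const_nhds

lemma integral_im_centeredLog_sq {γ : ℂ} (hγ : 0 < γ.im) :
    ∫ x, (centeredLog γ x).im ^ 2 ∂(cauchyLaw γ) = asympVar γ / 2 := by
  have h1 := integral_centeredLog_pow hγ one_ne_zero one_le_two
  simp only [pow_one] at h1
  have hint : Integrable (centeredLog γ) (cauchyLaw γ) :=
    (memLp_centeredLog hγ).integrable (by norm_num)
  have h2 : ∫ x, (centeredLog γ x).im ∂(cauchyLaw γ) = 0 := by
    have := Complex.imCLM.integral_comp_comm hint
    simpa [h1] using this
  have hi : Integrable (fun x => (centeredLog γ x).im) (cauchyLaw γ) := hint.im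
  have h3 : (fun x => (centeredLog γ x).im ^ 2) =ᵐ[cauchyLaw γ] fun x =>
      (π - 2 * arg γ) * (centeredLog γ x).im + arg γ * (π - arg γ) := by
    filter_upwards [ae_ne_zero_cauchyLaw hγ] with x hx using im_centeredLog_sq hγ hx
  rw [integral_congr_ae h3, integral_add (hi.const_mul _) (integrable_const _),
    integral_const_mul, h2]
  simp [asympVar]
  ring

lemma asympVar_pos {γ : ℂ} (hγ : 0 < γ.im) : 0 < asympVar γ := by
  have := arg_mem_Ioo hγ
  exact mul_pos (mul_pos two_pos this.1) (sub_pos.2 this.2)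

/-! ### Complex central limit theorem -/

lemma IsStdComplexNormal.aemeasurable {Ω' : Type*} [MeasurableSpace Ω'] {P' : Measure Ω'}
    {Z : Ω' → ℂ} (hZ : IsStdComplexNormal Z P') : AEMeasurable Z P' := by
  have h := (Complex.measurable_ofReal.comp_aemeasurable hZ.re_law.aemeasurable).add
    ((Complex.measurable_ofReal.comp_aemeasurable hZ.im_law.aemeasurable).mul_const Complex.I)
  refine h.congr (ae_of_all _ fun ω => ?_)
  exact Complex.re_add_im (Z ω)

/-- The Cramér–Wold reduction to real projections. -/
lemma charFun_map_eq_charFun_map_inner {Ω : Type*} [MeasurableSpace Ω] {P : Measure Ω}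
    {Y : Ω → ℂ} (hY : AEMeasurable Y P) (t : ℂ) :
    charFun (P.map Y) t = charFun (P.map fun ω => inner ℝ (Y ω) t) 1 := by
  rw [charFun_apply, charFun_apply, integral_map hY (by fun_prop), integral_map (by fun_prop)
    (by fun_prop)]
  simp

lemma IsStdComplexNormal.charFun_map {Ω' : Type*} [MeasurableSpace Ω'] {P' : Measure Ω'}
    [IsProbabilityMeasure P'] {Z : Ω' → ℂ} (hZ : IsStdComplexNormal Z P') (t : ℂ) :
    charFun (P'.map Z) t = Complex.exp (-(‖t‖ ^ 2 / 4 : ℝ)) := by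
  have hre := hZ.re_law.aemeasurable
  have him := hZ.im_law.aemeasurable
  have h1 : (fun ω => inner ℝ (Z ω) t) =
      (fun ω => t.re * (Z ω).re) + fun ω => t.im * (Z ω).im := by
    ext ω
    simp [Complex.inner]
  have hind : IndepFun (fun ω => t.re * (Z ω).re) (fun ω => t.im * (Z ω).im) P' :=
    hZ.indep.comp (φ := fun x => t.re * x) (ψ := fun x => t.im * x) (by fun_prop) (by fun_prop)
  rw [charFun_map_eq_charFun_map_inner hZ.aemeasurable, h1,
    hind.charFun_map_add_eq_mul (by fun_prop) (by fun_prop),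
    Pi.mul_apply, charFun_map_mul_comp hre, charFun_map_mul_comp him,
    hZ.re_law.map_eq, hZ.im_law.map_eq, charFun_gaussianReal, charFun_gaussianReal,
    ← Complex.exp_add, ← Complex.normSq_eq_norm_sq, Complex.normSq_apply]
  congr 1
  push_cast
  ring

/-- These are the real and imaginary parts of E V² = 0. -/
lemma integral_re_sq_eq {Ω : Type*} [MeasurableSpace Ω] {P : Measure Ω} {V : Ω → ℂ}
    (hV : MemLp V 2 P) (h2 : ∫ ω, V ω ^ 2 ∂P = 0) :
    ∫ ω, (V ω).re ^ 2 ∂P = ∫ ω, (V ω).im ^ 2 ∂P ∧ ∫ ω, (V ω).re * (V ω).im ∂P = 0 := by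
  have hr : MemLp (fun ω => (V ω).re) 2 P := hV.re
  have hi : MemLp (fun ω => (V ω).im) 2 P := hV.im
  have hsq : Integrable (fun ω => V ω ^ 2) P := by
    refine (hV.integrable_mul hV).congr (ae_of_all _ fun ω => ?_)
    simp [sq]
  have e1 := Complex.reCLM.integral_comp_comm hsq
  have e2 := Complex.imCLM.integral_comp_comm hsq
  rw [h2] at e1 e2
  simp only [Complex.reCLM_apply, Complex.imCLM_apply, sq, Complex.mul_re, Complex.mul_im,
    Complex.zero_re, Complex.zero_im] at e1 e2
  constructor
  · have i1 : Integrable (fun ω => (V ω).re * (V ω).re) P := hr.integrable_mul hr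
    have i2 : Integrable (fun ω => (V ω).im * (V ω).im) P := hi.integrable_mul hi
    rw [integral_sub i1 i2] at e1
    simp only [sq]
    exact sub_eq_zero.1 e1
  · have : ∀ ω, (V ω).re * (V ω).im + (V ω).im * (V ω).re = 2 * ((V ω).re * (V ω).im) :=
      fun ω => by ring
    simp_rw [this, integral_const_mul] at e2
    linarith

/-- Central limit theorem for circularly symmetric complex random variables. -/
theorem tendstoInDistribution_complex {Ω Ω' : Type*} [MeasurableSpace Ω] [MeasurableSpace Ω']
    {P : Measure Ω} [IsProbabilityMeasure P] {P' : Measure Ω'} [IsProbabilityMeasure P']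
    {V : ℕ → Ω → ℂ} (hV : MemLp (V 0) 2 P) (h1 : ∫ ω, V 0 ω ∂P = 0)
    (h2 : ∫ ω, V 0 ω ^ 2 ∂P = 0) (h3 : ∫ ω, (V 0 ω).im ^ 2 ∂P = 1 / 2)
    (hindep : iIndepFun V P) (hident : ∀ i, IdentDistrib (V i) (V 0) P P)
    {Z : Ω' → ℂ} (hZ : IsStdComplexNormal Z P') :
    TendstoInDistribution (fun (n : ℕ) ω => ((√n)⁻¹ : ℝ) • ∑ j ∈ Finset.range n, V j ω) atTop Z
      (fun _ => P) P' := by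
  have hmeas : ∀ i, AEMeasurable (V i) P := fun i => (hident i).aemeasurable_fst
  refine ⟨fun n => by fun_prop, hZ.aemeasurable, ?_⟩
  refine ProbabilityMeasure.tendsto_iff_tendsto_charFun.2 fun t ↦ ?_
  have hYm : MemLp (fun ω => inner ℝ (V 0 ω) t) 2 P := hV.inner_const t
  have hmean : ∫ ω, inner ℝ (V 0 ω) t ∂P = 0 := by
    have := integral_inner (𝕜 := ℝ) (hV.integrable (by norm_num)) t
    simp_rw [real_inner_comm t]
    rw [this, h1, inner_zero_right]
  -- The cross term vanishes and both parts have second moment 1/2, so the variance depends only on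
  -- ‖t‖.
  have hvar : Var[fun ω => inner ℝ (V 0 ω) t; P] = ‖t‖ ^ 2 / 2 := by
    rw [variance_of_integral_eq_zero hYm.aemeasurable hmean]
    have hr : MemLp (fun ω => (V 0 ω).re) 2 P := hV.re
    have hi : MemLp (fun ω => (V 0 ω).im) 2 P := hV.im
    obtain ⟨e1, e2⟩ := integral_re_sq_eq hV h2
    have : ∀ ω, (fun ω => inner ℝ (V 0 ω) t) ω ^ 2 = t.re ^ 2 * (V 0 ω).re ^ 2 +
        2 * t.re * t.im * ((V 0 ω).re * (V 0 ω).im) + t.im ^ 2 * (V 0 ω).im ^ 2 := fun ω => by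
      simp [Complex.inner]
      ring
    simp_rw [this]
    have i1 := hr.integrable_sq.const_mul (t.re ^ 2)
    have i2 : Integrable (fun ω => 2 * t.re * t.im * ((V 0 ω).re * (V 0 ω).im)) P :=
      (hr.integrable_mul hi).const_mul _
    have i3 := hi.integrable_sq.const_mul (t.im ^ 2)
    rw [integral_add (by exact i1.add i2) i3, integral_add i1 i2, integral_const_mul, integral_const_mul,
      integral_const_mul, e1, e2, h3, ← Complex.normSq_eq_norm_sq, Complex.normSq_apply]
    ring
  have hclt := tendstoInDistribution_inv_sqrt_mul_sum_sub
    (X := fun j ω => inner ℝ (V j ω) t) (P := P) (Y := id)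
    (P' := gaussianReal 0 Var[fun ω => inner ℝ (V 0 ω) t; P].toNNReal) HasLaw.id hYm
    (hindep.comp (fun _ z => inner ℝ z t) (fun _ => by fun_prop))
    (fun i => (hident i).comp (u := fun z => inner ℝ z t) (by fun_prop))
  have := (ProbabilityMeasure.tendsto_iff_tendsto_charFun.1 hclt.tendsto) 1
  simp only [ProbabilityMeasure.coe_mk, Measure.map_id, charFun_gaussianReal, hmean] at this ⊢
  rw [hZ.charFun_map]
  convert this using 2
  · rw [charFun_map_eq_charFun_map_inner (by fun_prop)]
    congr 2
    ext ω
    rw [real_inner_smul_left, sum_inner, mul_zero, sub_zero]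
  · rw [hvar, Real.coe_toNNReal _ (by positivity)]
    push_cast
    congr 1
    ring

/-! ### Geometric mean and delta method -/

lemma geomMean_eq {γ : ℂ} (hγ : 0 < γ.im) (k : ℤ) {x : ℕ → ℝ} (hx : ∀ j, x j ≠ 0) {N : ℕ}
    (hN : N ≠ 0) :
    geomMean k x N = γ * Complex.exp ((N : ℂ)⁻¹ * ∑ j ∈ Finset.range N, centeredLog γ (x j)) := by
  have hN' : (N : ℂ) ≠ 0 := by exact_mod_cast hN
  simp only [geomMean, pow]
  rw [← Complex.exp_sum]
  simp_rw [fun j => log_ofReal_eq hγ k (hx j)]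
  rw [← Finset.mul_sum, Finset.sum_add_distrib, Finset.sum_const, Finset.card_range, nsmul_eq_mul,
    mul_add, Complex.exp_add]
  have h : (((1 / (N : ℝ) : ℝ)) : ℂ) = (N : ℂ)⁻¹ := by simp
  rw [h, inv_mul_cancel_left₀ hN', exp_log (ne_zero_of_im_pos hγ)]

/-- The delta method for the complex exponential at the origin. -/
lemma tendstoInDistribution_sqrt_mul_exp_sub_one {Ω Ω' : Type*} [MeasurableSpace Ω]
    [MeasurableSpace Ω'] {P : Measure Ω} [IsProbabilityMeasure P] {P' : Measure Ω'}
    [IsProbabilityMeasure P'] {W : ℕ → Ω → ℂ} {Z : Ω' → ℂ} {c : ℝ} (hc : c ≠ 0)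
    (h : TendstoInDistribution W atTop Z (fun _ => P) P') :
    TendstoInDistribution (fun (N : ℕ) ω => ((√N : ℝ) : ℂ) / c *
      (Complex.exp (c / (√N : ℝ) * W N ω) - 1)) atTop Z (fun _ => P) P' := by
  -- The difference quotient of exp at 0 extends continuously with value 1 there, so Slutsky's
  -- theorem applies to W times this quotient at cW/√N.
  have hcont : Continuous (dslope Complex.exp 0) := by
    rw [← continuousOn_univ, continuousOn_dslope univ_mem]
    exact ⟨Complex.continuous_exp.continuousOn, Complex.differentiableAt_exp⟩
  have hs : Tendsto (fun N : ℕ => (c : ℂ) / (√N : ℝ)) atTop (𝓝 0) := by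
    have h1 : Tendsto (fun N : ℕ => c / √N) atTop (𝓝 0) :=
      (Real.tendsto_sqrt_atTop.comp tendsto_natCast_atTop_atTop).const_div_atTop c
    have := (Complex.continuous_ofReal.tendsto 0).comp h1
    simpa [Function.comp_def] using this
  have hslutsky := h.continuous_comp_prodMk_of_tendstoInMeasure_const
    (g := fun p : ℂ × ℂ => p.1 * dslope Complex.exp 0 (p.2 * p.1)) (by fun_prop)
    (Y := fun (N : ℕ) _ => (c : ℂ) / (√N : ℝ)) (c := 0)
    (tendstoInMeasure_of_tendsto_ae (fun _ => by fun_prop) (ae_of_all _ fun _ => hs))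
    (fun _ => by fun_prop)
  have hlim : (fun ω => Z ω * dslope Complex.exp 0 (0 * Z ω)) = Z := by
    ext ω
    simp
  simp only [hlim] at hslutsky
  have hW := h.forall_aemeasurable
  have key : ∀ N : ℕ, N ≠ 0 → ∀ ω, W N ω * dslope Complex.exp 0 (c / (√N : ℝ) * W N ω) =
      ((√N : ℝ) : ℂ) / c * (Complex.exp (c / (√N : ℝ) * W N ω) - 1) := by
    intro N hN ω
    have h1 : ((√N : ℝ) : ℂ) ≠ 0 := by
      have : √(N : ℝ) ≠ 0 := by positivity
      exact_mod_cast this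
    have h2 : (c : ℂ) ≠ 0 := by exact_mod_cast hc
    have h3 := sub_smul_dslope Complex.exp 0 (c / (√N : ℝ) * W N ω)
    rw [sub_zero, smul_eq_mul, Complex.exp_zero] at h3
    rw [← h3]
    field_simp
  -- The factorization in `key` needs √N ≠ 0, so the two sequences are only known to agree for N ≠
  -- 0.
  refine tendstoInDistribution_of_tendstoInMeasure_sub _ Z hslutsky ?_ (fun _ => by fun_prop)
  refine tendstoInMeasure_of_tendsto_ae (fun N => ?_) (ae_of_all _ fun ω => ?_)
  · have := hslutsky.forall_aemeasurable N
    exact (AEMeasurable.sub (by fun_prop) this).aestronglyMeasurable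
  · refine tendsto_const_nhds.congr' ?_
    filter_upwards [eventually_ne_atTop 0] with N hN
    simp [key N hN ω]

end CauchyGM

end

theorem mainTheorem3 {Ω Ω' : Type*} [MeasurableSpace Ω] [MeasurableSpace Ω']
    (P : Measure Ω) [IsProbabilityMeasure P] (P' : Measure Ω') [IsProbabilityMeasure P']
    (γ : ℂ) (hγ : 0 < γ.im) (k : ℤ)
    (X : ℕ → Ω → ℝ) (hlaw : ∀ j, HasLaw (X j) (CauchyGM.cauchyLaw γ) P)
    (hindep : iIndepFun X P)
    (Z : Ω' → ℂ) (hZ : CauchyGM.IsStdComplexNormal Z P') :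
    TendstoInDistribution
      (fun (N : ℕ) (ω : Ω) =>
        ((Real.sqrt N : ℝ) : ℂ) / (((Real.sqrt (CauchyGM.asympVar γ) : ℝ) : ℂ) * γ) *
          (CauchyGM.geomMean k (fun j => X j ω) N - γ))
      atTop Z (fun _ => P) P' := by
  set c : ℝ := Real.sqrt (CauchyGM.asympVar γ) with hcdef
  have hv := CauchyGM.asympVar_pos hγ
  have hc : 0 < c := Real.sqrt_pos.2 hv
  have hc2 : c ^ 2 = CauchyGM.asympVar γ := Real.sq_sqrt hv.le
  have hcC : (c : ℂ) ≠ 0 := by exact_mod_cast hc.ne'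
  -- Dividing by c = √v turns the variance v/2 of the imaginary part into 1/2.
  set f : ℝ → ℂ := fun x => CauchyGM.centeredLog γ x / c with hf
  have hfm : Measurable f := (CauchyGM.measurable_centeredLog hγ).div_const _
  have hfL : MemLp f 2 (CauchyGM.cauchyLaw γ) := by
    simpa [hf, div_eq_inv_mul] using (CauchyGM.memLp_centeredLog hγ).const_mul (c : ℂ)⁻¹
  have hfL' : MemLp (fun ω => f (X 0 ω)) 2 P := by
    have := hfL
    rw [← (hlaw 0).map_eq] at this
    exact this.comp_of_map (hlaw 0).aemeasurable
  have hcomp : ∀ {E : Type} [NormedAddCommGroup E] [NormedSpace ℝ E] (g : ℝ → E),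
      AEStronglyMeasurable g (CauchyGM.cauchyLaw γ) →
      ∫ ω, g (X 0 ω) ∂P = ∫ x, g x ∂(CauchyGM.cauchyLaw γ) :=
    fun g hg => (hlaw 0).integral_comp hg
  have hclt := CauchyGM.tendstoInDistribution_complex (P := P) (V := fun j ω => f (X j ω)) hfL'
    (by
      have h := CauchyGM.integral_centeredLog_pow hγ one_ne_zero one_le_two
      simp only [pow_one] at h
      rw [hcomp f (by fun_prop), integral_div, h, zero_div])
    (by
      have h := CauchyGM.integral_centeredLog_pow hγ two_ne_zero le_rfl
      rw [hcomp (fun x => f x ^ 2) (by fun_prop)]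
      simp only [hf, div_pow]
      rw [integral_div, h, zero_div])
    (by
      have h := CauchyGM.integral_im_centeredLog_sq hγ
      rw [hcomp (fun x => (f x).im ^ 2) (by fun_prop)]
      simp only [hf, Complex.div_ofReal_im, div_pow]
      rw [integral_div, h, hc2]
      field_simp)
    (hindep.comp (fun _ => f) (fun _ => hfm))
    (fun i => (IdentDistrib.comp ⟨(hlaw i).aemeasurable, (hlaw 0).aemeasurable,
      (hlaw i).map_eq.trans (hlaw 0).map_eq.symm⟩ hfm))
    hZ
  have hdelta := CauchyGM.tendstoInDistribution_sqrt_mul_exp_sub_one hc.ne' hclt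
  refine hdelta.congr (fun N => ?_) (ae_eq_refl _)
  have hae : ∀ᵐ ω ∂P, ∀ j, X j ω ≠ 0 := by
    refine ae_all_iff.2 fun j => ?_
    have h := CauchyGM.ae_ne_zero_cauchyLaw hγ
    rw [← (hlaw j).map_eq] at h
    exact ae_of_ae_map (hlaw j).aemeasurable h
  filter_upwards [hae] with ω hω
  rcases eq_or_ne N 0 with rfl | hN
  -- At N = 0 the factor √N makes both sides vanish.
  · simp
  have hγ0 := CauchyGM.ne_zero_of_im_pos hγ
  have hN0 : (0 : ℝ) < N := by exact_mod_cast Nat.pos_of_ne_zero hN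
  have hsq : ((Real.sqrt N : ℝ) : ℂ) * ((Real.sqrt N : ℝ) : ℂ) = N := by
    rw [← Complex.ofReal_mul, Real.mul_self_sqrt hN0.le, Complex.ofReal_natCast]
  have hs0 : ((Real.sqrt N : ℝ) : ℂ) ≠ 0 := by
    exact_mod_cast (Real.sqrt_pos.2 hN0).ne'
  have harg : (c : ℂ) / (Real.sqrt N : ℝ) *
      ((Real.sqrt N)⁻¹ • ∑ j ∈ Finset.range N, f (X j ω)) =
      (N : ℂ)⁻¹ * ∑ j ∈ Finset.range N, CauchyGM.centeredLog γ (X j ω) := by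
    simp only [hf]
    rw [← Finset.sum_div, Complex.real_smul, Complex.ofReal_inv, ← hsq]
    field_simp
  rw [CauchyGM.geomMean_eq hγ k hω hN, harg]
  field_simp
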